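/- Let $P$ be a finite poset and $d=|P|$. The order polytope $\mathcal O(P)\subset\mathbb R^{P}$ is the set of all $a$ with $0\le a_x\le 1$ for all $x\in P$ and $a_x\ge a_y$ whenever $x\le y$. The chain polytope $\mathcal C(P)\subset\mathbb R^{P}$ is the set of all $a$ with $a_x\ge 0$ for all $x\in P$ and $\sum_{x\in K}a_x\le 1$ for every maximal chain $K$ of $P$. The $1$-skeleton of a polytope is the finite simple graph formed by its vertices and edges, and the degree sequence of a finite simple graph is the list of its vertex degrees in weakly increasing order. Two such polytopes $\mathcal P,\mathcal Q$ are unimodularly equivalent if $\mathcal Q=\{vU+w: v\in\mathcal P\}$ for some integer matrix $U$ with $\det U=\pm1$ and some integer vector $w$. Theorem. The $1$-skeletons of $\mathcal O(P)$ and $\mathcal C(P)$ have the same degree sequence if and only if $\mathcal O(P)$ and $\mathcal C(P)$ are unimodularly equivalent. Moreover, if $\mathcal O(P)$ and $\mathcal C(P)$ are not unimodularly equivalent, then (1) there are $a,b,c,g,h\in P$ with $a<c$, $b<c$, $c<g$, $c<h$, where $a,b$ are incomparable and $g,h$ are incomparable; (2) the origin is a vertex of $\mathcal C(P)$ and has degree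 $d$ in the $1$-skeleton of $\mathcal C(P)$; (3) every vertex of $\mathcal O(P)$ has degree at least $d+1$ in the $1$-skeleton of $\mathcal O(P)$. -/

import Mathlib

/-- The order polytope `O(P) ⊂ ℝ^P`: all `a` with `0 ≤ a i ≤ 1`, and `a i ≥ a j` if `i ≤ j`. -/
def orderPolytope (P : Type*) [PartialOrder P] : Set (P → ℝ) :=
  {a | (∀ i, 0 ≤ a i ∧ a i ≤ 1) ∧ ∀ i j, i ≤ j → a j ≤ a i}

/-- The chain polytope `C(P) ⊂ ℝ^P`: all `a ≥ 0` whose sum over every maximal chain of `P` is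
at most `1`. -/
def chainPolytope (P : Type*) [PartialOrder P] : Set (P → ℝ) :=
  {a | (∀ i, 0 ≤ a i) ∧
    ∀ s : Finset P, IsMaxChain (· ≤ ·) (s : Set P) → ∑ i ∈ s, a i ≤ 1}

/-- The set of vertices of a polytope `S ⊂ ℝ^ι`: the points `v` such that `{v}` is a face, that is,
the intersection of `S` with a supporting hyperplane. -/
def polytopeVertices {ι : Type*} (S : Set (ι → ℝ)) : Set (ι → ℝ) :=
  Set.exposedPoints ℝ S

/-- The `1`-skeleton of a polytope `S ⊂ ℝ^ι`: the simple graph on the vertices of `S` in which two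
distinct vertices are adjacent when the segment joining them is a face of `S`. -/
def oneSkeleton {ι : Type*} (S : Set (ι → ℝ)) : SimpleGraph (polytopeVertices S) where
  Adj v w := v ≠ w ∧ IsExposed ℝ S (segment ℝ (v : ι → ℝ) (w : ι → ℝ))
  symm := ⟨fun v w h => ⟨h.1.symm, by rw [segment_symm]; exact h.2⟩⟩
  loopless := ⟨fun _ h => h.1 rfl⟩

/-- The degree of a vertex of a finite simple graph. -/
noncomputable def vertexDegree {V : Type*} (G : SimpleGraph V) (v : V) : ℕ :=
  (G.neighborSet v).ncard

/-- The degree sequence of a finite simple graph: the list of the degrees of all its vertices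
(with repetitions), in weakly increasing order. -/
noncomputable def degreeSequence {V : Type*} [Finite V] (G : SimpleGraph V) : List ℕ :=
  letI := Fintype.ofFinite V
  ((Finset.univ : Finset V).val.map (vertexDegree G)).sort (· ≤ ·)

/-- `S` and `T` are unimodularly equivalent: `T = f_U(S) + w` for an integer matrix `U` of
determinant `±1` and an integer vector `w`, where `f_U(v) = v U`. -/
def UnimodularlyEquivalent {ι : Type*} [Fintype ι] [DecidableEq ι] (S T : Set (ι → ℝ)) : Prop :=
  ∃ (U : Matrix ι ι ℤ) (w : ι → ℤ), (U.det = 1 ∨ U.det = -1) ∧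
    T = (fun v : ι → ℝ => Matrix.vecMul v (U.map (Int.cast : ℤ → ℝ)) + fun i => (w i : ℝ)) '' S

/-- The five-element poset with `a, b < c < g, h` (`a`, `b` incomparable and `g`, `h` incomparable)
appears as a subposet of `P`. -/
def HasSubposetX (P : Type*) [PartialOrder P] : Prop :=
  ∃ a b c g h : P, a < c ∧ b < c ∧ c < g ∧ c < h ∧
    ¬ a ≤ b ∧ ¬ b ≤ a ∧ ¬ g ≤ h ∧ ¬ h ≤ g

/-- A set cut out by finitely many linear inequalities has finitely many vertices. -/
theorem polytopeVertices_finite {ι K : Type*} [Finite K] (S : Set (ι → ℝ))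
    (l : K → (ι → ℝ) →ₗ[ℝ] ℝ) (c : K → ℝ) (hS : ∀ x, x ∈ S ↔ ∀ k, l k x ≤ c k) :
    (polytopeVertices S).Finite := by
  refine Set.Finite.of_injOn (f := fun x => {k | l k x = c k}) (t := Set.univ)
    (fun _ _ => Set.mem_univ _) ?_ Set.finite_univ
  intro x hx y hy hxy
  have hx' := exposedPoints_subset_extremePoints hx
  have hxS := (hS x).1 hx'.1
  have hyS : y ∈ S := (exposedPoints_subset_extremePoints hy).1
  have hev : ∀ᶠ ε : ℝ in nhdsWithin 0 (Set.Ioi 0), ∀ k, l k x + ε * l k (x - y) ≤ c k := by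
    rw [Filter.eventually_all]
    intro k
    rcases (hxS k).eq_or_lt with h | h
    · have h2 : l k y = c k := by
        have : k ∈ {k | l k x = c k} := h
        rw [show {k | l k x = c k} = {k | l k y = c k} from hxy] at this
        exact this
      refine Filter.Eventually.of_forall fun ε => ?_
      rw [map_sub, h, h2]
      simp
    · have hc : Filter.Tendsto (fun ε : ℝ => l k x + ε * l k (x - y)) (nhds 0)
          (nhds (l k x + 0 * l k (x - y))) := by
        apply Continuous.tendsto (f := fun ε : ℝ => l k x + ε * l k (x - y))
        fun_prop
      have := hc.eventually_lt_const (u := c k) (by simpa using h)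
      exact (this.filter_mono nhdsWithin_le_nhds).mono fun ε h => h.le
  obtain ⟨ε, hε, hpos⟩ := (hev.and self_mem_nhdsWithin).exists
  have hpos : (0 : ℝ) < ε := hpos
  have hp : x + ε • (x - y) ∈ S := by
    rw [hS]
    intro k
    simpa using hε k
  refine (hx'.2 hyS hp ?_).symm
  refine ⟨ε / (1 + ε), 1 / (1 + ε), by positivity, by positivity, by field_simp; ring, ?_⟩
  ext i
  simp only [Pi.add_apply, Pi.smul_apply, Pi.sub_apply, smul_eq_mul]
  field_simp
  ring

instance orderPolytope_finite_vertices (P : Type*) [PartialOrder P] [Finite P] :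
    Finite (polytopeVertices (orderPolytope P)) := by
  refine (polytopeVertices_finite (K := P ⊕ P ⊕ {p : P × P // p.1 ≤ p.2}) _
    (Sum.elim (fun i => -LinearMap.proj i) (Sum.elim (fun i => LinearMap.proj i)
      (fun p => (LinearMap.proj p.1.2 : (P → ℝ) →ₗ[ℝ] ℝ) - LinearMap.proj p.1.1)))
    (Sum.elim (fun _ => 0) (Sum.elim (fun _ => 1) (fun _ => 0))) fun x => ?_).to_subtype
  simp [orderPolytope, forall_and, and_assoc]

instance chainPolytope_finite_vertices (P : Type*) [PartialOrder P] [Finite P] :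
    Finite (polytopeVertices (chainPolytope P)) := by
  refine (polytopeVertices_finite (K := P ⊕ {s : Finset P // IsMaxChain (· ≤ ·) (s : Set P)}) _
    (Sum.elim (fun i => -LinearMap.proj i) (fun s => ∑ i ∈ s.1, LinearMap.proj i))
    (Sum.elim (fun _ => 0) (fun _ => 1)) fun x => ?_).to_subtype
  simp [chainPolytope]

/-! Everything turns on whether `P` contains the five-element poset of `HasSubposetX`. If it does
not, above or below each element lies a chain (`isChain_Ici_or_isChain_Iic`). Summing `b` over the
principal filter where that is a chain, and taking one minus the sum over the principal ideal
elsewhere, gives a unimodular affine map that carries the chain polytope onto the order polytope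
(`unimodularlyEquivalent_of_not_hasSubposetX`). Affine automorphisms preserve faces, hence degree
sequences.

If `P` does contain it, the number `|P|` separates the degree sequences. The neighbours of the
origin in the chain polytope are exactly the unit vectors, so `|P|` occurs there
(`vertexDegree_zero_chainPolytope`). In the order polytope the vertices are indicators of lower sets
`I`. Each `x` yields a neighbour: remove from `I` everything above `x` if `x ∈ I`, otherwise add
everything below `x`. The five-element poset supplies one more, so every degree exceeds `|P|`
(`exists_injective_neighbors`). -/

/-- The set where finitely many valid linear inequalities of `S` are tight is an exposed face. -/
theorem isExposed_of_tight {ι K : Type*} [Finite ι] [Finite K] {S B : Set (ι → ℝ)}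
    (l : K → (ι → ℝ) →ₗ[ℝ] ℝ) (c : K → ℝ) (hl : ∀ x ∈ S, ∀ k, l k x ≤ c k)
    (hB : ∀ x, x ∈ B ↔ x ∈ S ∧ ∀ k, l k x = c k) : IsExposed ℝ S B := by
  have := Fintype.ofFinite K
  rintro ⟨z, hz⟩
  obtain ⟨hzS, hz⟩ := (hB z).1 hz
  have hle : ∀ y ∈ S, ∑ k, l k y ≤ ∑ k, c k := fun y hy =>
    Finset.sum_le_sum fun k _ => hl y hy k
  -- The summed functional reaches `∑ c k` exactly where every summand is tight, and `z` shows that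
  -- this bound is attained.
  refine ⟨LinearMap.toContinuousLinearMap (∑ k, l k), Set.ext fun x => ?_⟩
  simp only [hB, Set.mem_ofPred_eq, LinearMap.coe_toContinuousLinearMap', LinearMap.sum_apply]
  refine and_congr_right fun hx => ⟨fun h y hy => ?_, fun h => ?_⟩
  · simpa [h] using hle y hy
  · have h1 : ∑ k, l k x = ∑ k, c k :=
      le_antisymm (hle x hx) (by simpa [hz] using h z hzS)
    simpa using (Finset.sum_eq_sum_iff_of_le fun k _ => hl x hx k).1 h1

/-! ### Affine invariance of faces, skeletons and degrees -/

/-- An affine automorphism carries exposed faces to exposed faces. -/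
theorem IsExposed.image_affine {ι : Type*} [Finite ι] {S B : Set (ι → ℝ)}
    (e : (ι → ℝ) ≃ᵃ[ℝ] (ι → ℝ)) (h : IsExposed ℝ S B) : IsExposed ℝ (e '' S) (e '' B) := by
  intro hne
  obtain ⟨l, rfl⟩ := h (Set.image_nonempty.1 hne)
  have key : ∀ x y, l (e.linear.symm (e x)) ≤ l (e.linear.symm (e y)) ↔ l x ≤ l y := by
    intro x y
    have : e.linear.symm (e x) - e.linear.symm (e y) = x - y := by
      rw [← map_sub, LinearEquiv.symm_apply_eq]
      exact (e.toAffineMap.linearMap_vsub x y).symm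
    have := congrArg l this
    rw [map_sub, map_sub] at this
    constructor <;> intro <;> linarith
  refine ⟨l.comp (LinearMap.toContinuousLinearMap e.linear.symm.toLinearMap), Set.ext fun x => ?_⟩
  constructor
  · rintro ⟨x, ⟨hx, hmax⟩, rfl⟩
    refine ⟨⟨x, hx, rfl⟩, ?_⟩
    rintro _ ⟨y, hy, rfl⟩
    exact (key y x).2 (hmax y hy)
  · rintro ⟨⟨x, hx, rfl⟩, hmax⟩
    exact ⟨x, ⟨hx, fun y hy => (key y x).1 (hmax _ ⟨y, hy, rfl⟩)⟩, rfl⟩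

theorem isExposed_image_affine_iff {ι : Type*} [Finite ι] {S B : Set (ι → ℝ)}
    (e : (ι → ℝ) ≃ᵃ[ℝ] (ι → ℝ)) : IsExposed ℝ (e '' S) (e '' B) ↔ IsExposed ℝ S B := by
  refine ⟨fun h => ?_, fun h => h.image_affine e⟩
  have hs : ∀ A : Set (ι → ℝ), e.symm '' (e '' A) = A := fun A => by
    simp [Set.image_image]
  simpa only [hs] using h.image_affine e.symm

/-- Affinely equivalent polytopes have isomorphic `1`-skeletons. -/
noncomputable def oneSkeletonIso {ι : Type*} [Finite ι] (S : Set (ι → ℝ))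
    (e : (ι → ℝ) ≃ᵃ[ℝ] (ι → ℝ)) : oneSkeleton S ≃g oneSkeleton (e '' S) where
  toEquiv := e.toEquiv.subtypeEquiv fun v => by
    rw [polytopeVertices, polytopeVertices, mem_exposedPoints_iff_exposed_singleton,
      mem_exposedPoints_iff_exposed_singleton, ← isExposed_image_affine_iff e]
    simp
  map_rel_iff' := by
    intro v w
    have h := image_segment ℝ e.toAffineMap (v : ι → ℝ) w
    have h2 := isExposed_image_affine_iff (S := S) (B := segment ℝ (v : ι → ℝ) w) e
    simp only [AffineEquiv.coe_toAffineMap] at h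
    rw [h] at h2
    simp [oneSkeleton, h2, Subtype.ext_iff]

theorem vertexDegree_iso {V W : Type*} {G : SimpleGraph V} {H : SimpleGraph W} (e : G ≃g H)
    (v : V) : vertexDegree H (e v) = vertexDegree G v := by
  unfold vertexDegree
  rw [← Set.ncard_image_of_injective _ e.injective]
  congr 1
  ext w
  simp only [SimpleGraph.mem_neighborSet, Set.mem_image]
  constructor
  · intro h
    exact ⟨e.symm w, by rw [← e.map_adj_iff]; simpa using h, by simp⟩
  · rintro ⟨u, hu, rfl⟩
    exact e.map_adj_iff.2 hu

theorem mem_degreeSequence {V : Type*} [Finite V] {G : SimpleGraph V} {n : ℕ} :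
    n ∈ degreeSequence G ↔ ∃ v, vertexDegree G v = n := by
  simp [degreeSequence]

theorem degreeSequence_iso {V W : Type*} [Finite V] [Finite W] {G : SimpleGraph V}
    {H : SimpleGraph W} (e : G ≃g H) : degreeSequence G = degreeSequence H := by
  unfold degreeSequence
  let := Fintype.ofFinite V
  let := Fintype.ofFinite W
  have : (Finset.univ : Finset W) = Finset.univ.map e.toEquiv.toEmbedding := by simp
  simp only [this, Finset.map_val, Multiset.map_map]
  congr 1
  exact Multiset.map_congr rfl fun v _ => (vertexDegree_iso e v).symm

/-! ### Unimodular matrices and equivalence -/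

section Unimodular
variable {ι : Type*} [Fintype ι] [DecidableEq ι]

theorem isUnit_det_map_intCast {U : Matrix ι ι ℤ} (hU : U.det = 1 ∨ U.det = -1) :
    IsUnit (U.map (Int.cast : ℤ → ℝ)).det := by
  have h : (U.map (Int.cast : ℤ → ℝ)).det = ((U.det : ℤ) : ℝ) := (Int.cast_det U).symm
  rw [h]
  rcases hU with h | h <;> simp [h]

/-- The affine automorphism `v ↦ v U + w` given by a unimodular matrix `U`. -/
noncomputable def unimodularAffineEquiv (U : Matrix ι ι ℤ) (hU : U.det = 1 ∨ U.det = -1)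
    (w : ι → ℝ) : (ι → ℝ) ≃ᵃ[ℝ] (ι → ℝ) :=
  (LinearEquiv.ofBijective (Matrix.vecMulLinear (U.map (Int.cast : ℤ → ℝ)))
    ⟨Matrix.vecMul_injective_of_isUnit
      ((Matrix.isUnit_iff_isUnit_det _).2 (isUnit_det_map_intCast hU)),
      Matrix.vecMul_surjective_iff_isUnit.2
      ((Matrix.isUnit_iff_isUnit_det _).2 (isUnit_det_map_intCast hU))⟩).toAffineEquiv.trans
    (AffineEquiv.constVAdd ℝ (ι → ℝ) w)

theorem unimodularAffineEquiv_apply (U : Matrix ι ι ℤ) (hU : U.det = 1 ∨ U.det = -1)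
    (w v : ι → ℝ) : unimodularAffineEquiv U hU w v =
      Matrix.vecMul v (U.map (Int.cast : ℤ → ℝ)) + w := by
  simp only [unimodularAffineEquiv, AffineEquiv.trans_apply, AffineEquiv.constVAdd_apply,
    vadd_eq_add, add_comm w]
  rfl

theorem UnimodularlyEquivalent.degreeSequence_eq {S T : Set (ι → ℝ)}
    [Finite (polytopeVertices S)] [Finite (polytopeVertices T)]
    (h : UnimodularlyEquivalent S T) :
    degreeSequence (oneSkeleton S) = degreeSequence (oneSkeleton T) := by
  obtain ⟨U, w, hU, hT⟩ := h
  have : T = unimodularAffineEquiv U hU (fun i => (w i : ℝ)) '' S := by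
    rw [hT]
    exact Set.image_congr fun v _ => (unimodularAffineEquiv_apply U hU _ v).symm
  subst this
  exact degreeSequence_iso (oneSkeletonIso S _)

/-- A set `S` is unimodularly equivalent to `T` if `S` is the preimage of `T` under a unimodular
affine map. -/
theorem unimodularlyEquivalent_of_preimage {S T : Set (ι → ℝ)} (M : Matrix ι ι ℤ) (w : ι → ℤ)
    (hM : M.det = 1 ∨ M.det = -1)
    (h : ∀ v, v ∈ T ↔ Matrix.vecMul v (M.map (Int.cast : ℤ → ℝ)) + (fun i => (w i : ℝ)) ∈ S) :
    UnimodularlyEquivalent S T := by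
  have hu : IsUnit M.det := Int.isUnit_iff.2 hM
  refine ⟨M⁻¹, -Matrix.vecMul w M⁻¹, ?_, Set.ext fun v => ?_⟩
  · have h1 : M.det * M⁻¹.det = 1 := by
      rw [← Matrix.det_mul, Matrix.mul_nonsing_inv _ hu, Matrix.det_one]
    rcases hM with h | h <;> rw [h] at h1 <;> omega
  have hc : ∀ A B : Matrix ι ι ℤ, A.map (Int.cast : ℤ → ℝ) * B.map (Int.cast : ℤ → ℝ) =
      (A * B).map Int.cast := fun A B => (Matrix.map_mul_intCast (A := A) (B := B)).symm
  have h1 : M.map (Int.cast : ℤ → ℝ) * M⁻¹.map (Int.cast : ℤ → ℝ) = 1 := by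
    rw [hc, Matrix.mul_nonsing_inv _ hu]; simp
  have h2 : M⁻¹.map (Int.cast : ℤ → ℝ) * M.map (Int.cast : ℤ → ℝ) = 1 := by
    rw [hc, Matrix.nonsing_inv_mul _ hu]; simp
  have h3 : (fun i => ((-Matrix.vecMul w M⁻¹) i : ℝ)) =
      -Matrix.vecMul (fun i => (w i : ℝ)) (M⁻¹.map (Int.cast : ℤ → ℝ)) := by
    ext i
    simp [Matrix.vecMul, dotProduct]
  rw [h3, h, Set.mem_image]
  constructor
  · intro hv
    refine ⟨_, hv, ?_⟩
    simp [Matrix.add_vecMul, Matrix.vecMul_vecMul, h1]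
  · rintro ⟨a, ha, rfl⟩
    simpa [Matrix.add_vecMul, Matrix.neg_vecMul, Matrix.vecMul_vecMul, h2] using ha

/-- A matrix that is triangular along an injective ranking of the index type, with units on the
diagonal, is unimodular. -/
theorem det_eq_one_or_neg_one_of_triangular {κ : Type*} [LinearOrder κ]
    (M : Matrix ι ι ℤ) (e : ι → κ) (he : Function.Injective e) (hM : ∀ i j, M i j ≠ 0 → e i ≤ e j)
    (hd : ∀ i, IsUnit (M i i)) : M.det = 1 ∨ M.det = -1 := by
  let := LinearOrder.lift' e he
  rw [← Int.isUnit_iff, Matrix.det_of_isUpperTriangular]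
  · exact (IsUnit.prod_univ_iff (f := fun i => M i i)).2 hd
  · intro i j hij
    by_contra h
    exact absurd (hM i j h) (not_le.2 hij)

end Unimodular

/-! ### Order polytope: lower sets and a lower bound on degrees -/

section OrderPolytope
variable {P : Type*} [PartialOrder P]

theorem indicator_mem_orderPolytope {I : Set P} (hI : IsLowerSet I) :
    I.indicator (1 : P → ℝ) ∈ orderPolytope P := by
  classical
  refine ⟨fun i => ?_, fun i j hij => ?_⟩
  · by_cases h : i ∈ I <;> simp [h]
  · by_cases h : j ∈ I
    · simp [h, hI hij h]
    · by_cases h' : i ∈ I <;> simp [h, h']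

/-- A point `v` is the midpoint of `min (2v) 1` and `max (2v - 1) 0`, both of which stay in the
polytope. Extremality forces `v = min (2v) 1`, so all coordinates are 0 or 1. -/
theorem exists_eq_indicator_of_mem_polytopeVertices {v : P → ℝ}
    (hv : v ∈ polytopeVertices (orderPolytope P)) :
    ∃ I : Set P, IsLowerSet I ∧ v = I.indicator 1 := by
  have hv := exposedPoints_subset_extremePoints hv
  obtain ⟨h01, hmono⟩ := hv.1
  have h1 : (fun i => min (2 * v i) 1) ∈ orderPolytope P :=
    ⟨fun i => ⟨le_min (by linarith [(h01 i).1]) zero_le_one, min_le_right _ _⟩,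
      fun i j hij => min_le_min_right _ (by linarith [hmono i j hij])⟩
  have h2 : (fun i => max (2 * v i - 1) 0) ∈ orderPolytope P :=
    ⟨fun i => ⟨le_max_right _ _, max_le (by linarith [(h01 i).2]) zero_le_one⟩,
      fun i j hij => max_le_max_right _ (by linarith [hmono i j hij])⟩
  have h := hv.2 h1 h2 ⟨1 / 2, 1 / 2, by norm_num, by norm_num, by norm_num, by
    ext i
    simp only [Pi.add_apply, Pi.smul_apply, smul_eq_mul]
    rcases le_total (2 * v i) 1 with h | h
    · rw [min_eq_left h, max_eq_right (by linarith)]; ring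
    · rw [min_eq_right h, max_eq_left (by linarith)]; ring⟩
  have hcases : ∀ i, v i = 0 ∨ v i = 1 := fun i => by
    have hi : min (2 * v i) 1 = v i := congrFun h i
    rcases min_choice (2 * v i) 1 with h' | h' <;> rw [h'] at hi
    · left; linarith
    · right; exact hi.symm
  refine ⟨{i | v i = 1}, fun j i hij hj => ?_, ?_⟩
  · exact le_antisymm (h01 i).2 (hj.symm.le.trans (hmono i j hij))
  · ext i
    rcases hcases i with h | h <;> simp [Set.indicator, h]

variable [Finite P]

theorem indicator_mem_polytopeVertices {I : Set P} (hI : IsLowerSet I) :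
    I.indicator (1 : P → ℝ) ∈ polytopeVertices (orderPolytope P) := by
  rw [polytopeVertices, mem_exposedPoints_iff_exposed_singleton]
  refine isExposed_of_tight (K := I ⊕ (Iᶜ : Set P))
    (Sum.elim (fun i => LinearMap.proj (i : P)) (fun i => -LinearMap.proj (i : P)))
    (Sum.elim (fun _ => 1) (fun _ => 0)) ?_ fun x => ?_
  · rintro x hx (k | k)
    · exact (hx.1 k).2
    · simpa using (hx.1 k).1
  · simp only [Set.mem_singleton_iff]
    constructor
    · rintro rfl
      refine ⟨indicator_mem_orderPolytope hI, ?_⟩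
      rintro (⟨k, hk⟩ | ⟨k, hk⟩)
      · simp [hk]
      · simpa using hk
    · rintro ⟨-, h⟩
      ext i
      by_cases hi : i ∈ I
      · simpa [hi] using h (.inl ⟨i, hi⟩)
      · simpa [hi] using h (.inr ⟨i, hi⟩)

/-- The indicator of a lower set, as a vertex of the order polytope. -/
noncomputable def lowerSetVertex (I : LowerSet P) : polytopeVertices (orderPolytope P) :=
  ⟨(I : Set P).indicator 1, indicator_mem_polytopeVertices I.lower⟩

theorem lowerSetVertex_injective : Function.Injective (lowerSetVertex (P := P)) := by
  intro I J h
  have h : (I : Set P).indicator (1 : P → ℝ) = (J : Set P).indicator 1 := congrArg Subtype.val h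
  exact SetLike.coe_injective (Set.indicator_one_inj ℝ h)

/-- If `I < J` are lower sets and `J \ I` is connected (every function that agrees on comparable
elements of `J \ I` is constant there), their vertices are adjacent in the order polytope. -/
theorem oneSkeleton_adj_of_connected {I J : LowerSet P} (hIJ : I < J)
    (hconn : ∀ f : P → ℝ, (∀ u v, u ≤ v → v ∈ J → u ∉ I → f u = f v) →
      ∃ t, ∀ u ∈ J, u ∉ I → f u = t) :
    (oneSkeleton (orderPolytope P)).Adj (lowerSetVertex I) (lowerSetVertex J) := by
  classical
  refine ⟨fun h => hIJ.ne (lowerSetVertex_injective h), ?_⟩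
  have hsub : ∀ {i}, i ∈ I → i ∈ J := fun h => hIJ.le h
  -- Tightness means value 1 on `I`, 0 off `J`, and equality along comparabilities in `J \ I`.
  -- Connectedness then leaves one parameter `t`, and the point is `(1 - t) 1_I + t 1_J`.
  refine isExposed_of_tight
    (K := {i // i ∈ I} ⊕ {i // i ∉ J} ⊕ {p : P × P // p.1 ≤ p.2 ∧ p.2 ∈ J ∧ p.1 ∉ I})
    (Sum.elim (fun i => LinearMap.proj i.1) (Sum.elim (fun i => -LinearMap.proj i.1)
      (fun p => (LinearMap.proj p.1.2 : (P → ℝ) →ₗ[ℝ] ℝ) - LinearMap.proj p.1.1)))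
    (Sum.elim (fun _ => 1) (fun _ => 0)) ?_ fun x => ?_
  · rintro x hx (k | k | k)
    · exact (hx.1 k).2
    · simpa using (hx.1 k).1
    · simpa using hx.2 _ _ k.2.1
  · have hval : ∀ a b : ℝ, a + b = 1 → ∀ i, (a • (I : Set P).indicator (1 : P → ℝ) +
        b • (J : Set P).indicator (1 : P → ℝ)) i =
        if i ∈ I then 1 else if i ∈ J then b else 0 := by
      intro a b hab i
      by_cases h1 : i ∈ I
      · simp [h1, hsub h1, hab]
      · by_cases h2 : i ∈ J <;> simp [h1, h2]
    constructor
    · rintro ⟨a, b, ha, hb, hab, rfl⟩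
      have hb1 : b ≤ 1 := by linarith
      have hv := hval a b hab
      simp only [lowerSetVertex]
      refine ⟨⟨fun i => ?_, fun i j hij => ?_⟩, ?_⟩
      · rw [hv]; split_ifs <;> simp [hb, hb1]
      · rw [hv, hv]
        by_cases h1 : j ∈ I
        · have h1' : i ∈ I := I.lower hij h1
          simp [h1, h1']
        · by_cases h2 : j ∈ J
          · have h2' : i ∈ J := J.lower hij h2
            simp only [h1, h2, h2', if_true, if_false]; split_ifs <;> simp [hb1]
          · simp only [h1, h2, if_false]; split_ifs <;> simp [hb]
      · rintro (⟨k, hk⟩ | ⟨k, hk⟩ | ⟨⟨i, j⟩, hij, hj, hi⟩)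
        · simp only [Sum.elim_inl, LinearMap.proj_apply, hv, hk, if_true]
        · have : k ∉ I := fun h => hk (hsub h)
          simp only [Sum.elim_inl, Sum.elim_inr, LinearMap.neg_apply, LinearMap.proj_apply, hv, hk,
            this, if_false, neg_zero]
        · have h1 : j ∉ I := fun h => hi (I.lower hij h)
          have h2 : i ∈ J := J.lower hij hj
          simp only at hi hj
          simp only [Sum.elim_inr, LinearMap.sub_apply, LinearMap.proj_apply, hv, hi, hj, h1, h2,
            if_false, if_true, sub_self]
    · rintro ⟨hx, h⟩
      obtain ⟨t, ht⟩ := hconn x fun u v huv hv hu => by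
        have := h (.inr (.inr ⟨(u, v), huv, hv, hu⟩))
        simp only [Sum.elim_inr, LinearMap.sub_apply, LinearMap.proj_apply] at this
        linarith
      obtain ⟨j, hj, hj'⟩ := Set.not_subset.1 hIJ.not_ge
      have htj := ht j hj hj'
      refine ⟨1 - t, t, by linarith [(hx.1 j).2], by linarith [(hx.1 j).1], by ring, ?_⟩
      ext i
      simp only [lowerSetVertex]
      rw [hval _ _ (by ring)]
      split_ifs with h1 h2
      · simpa using (h (.inl ⟨i, h1⟩)).symm
      · exact (ht i h2 h1).symm
      · simpa [eq_comm] using h (.inr (.inl ⟨i, h2⟩))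

/-- In a poset with the five-element subposet, every lower set has more than `|P|` neighbours in
the `1`-skeleton of the order polytope. -/
theorem exists_injective_neighbors (hX : HasSubposetX P) (I : LowerSet P) :
    ∃ F : Option P → LowerSet P, Function.Injective F ∧
      ∀ o, (oneSkeleton (orderPolytope P)).Adj (lowerSetVertex I) (lowerSetVertex (F o)) := by
  classical
  obtain ⟨a, b, c, g, h, hac, hbc, hcg, hch, hab, hba, hgh, hhg⟩ := hX
  let up : P → LowerSet P := fun x => ⟨{i | i ∈ I ∨ i ≤ x}, by
    rintro i j hij (hi | hi)
    exacts [.inl (I.lower hij hi), .inr (hij.trans hi)]⟩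
  let dn : P → LowerSet P := fun x => ⟨{i | i ∈ I ∧ ¬ x ≤ i}, by
    rintro i j hij ⟨hi, hi'⟩
    exact ⟨I.lower hij hi, fun h => hi' (h.trans hij)⟩⟩
  have mem_up : ∀ x i, i ∈ up x ↔ i ∈ I ∨ i ≤ x := fun _ _ => Iff.rfl
  have mem_dn : ∀ x i, i ∈ dn x ↔ i ∈ I ∧ ¬ x ≤ i := fun _ _ => Iff.rfl
  let G : P → LowerSet P := fun x => if x ∈ I then dn x else up x
  let E : LowerSet P := if c ∈ I then dn a ⊓ dn b else up g ⊔ up h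
  have lt_up : ∀ {x}, x ∉ I → I < up x := fun {x} hx =>
    lt_of_le_of_ne (fun i hi => .inl hi) fun h => hx (h ▸ (mem_up x x).2 (.inr le_rfl))
  have dn_lt : ∀ {x}, x ∈ I → dn x < I := fun {x} hx =>
    lt_of_le_of_ne (fun i hi => hi.1) fun h => ((mem_dn x x).1 (h ▸ hx)).2 le_rfl
  -- `x` is the least element of `I \ dn x`, respectively the greatest of `up x \ I`; a removal and
  -- an addition lie on opposite sides of `I`.
  have hG : Function.Injective G := by
    intro x y hxy
    by_cases hx : x ∈ I <;> by_cases hy : y ∈ I <;> simp only [G, hx, hy, if_true, if_false] at hxy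
    · have h1 := mem_dn x y
      have h2 := mem_dn y x
      rw [hxy, mem_dn] at h1
      rw [← hxy, mem_dn] at h2
      simp only [hx, hy, true_and, le_refl, not_true] at h1 h2
      exact le_antisymm (by tauto) (by tauto)
    · exact absurd (hxy ▸ dn_lt hx) (lt_up hy).not_gt
    · exact absurd (hxy ▸ lt_up hx) (dn_lt hy).not_gt
    · have h1 := mem_up x y
      have h2 := mem_up y x
      rw [hxy, mem_up] at h1
      rw [← hxy, mem_up] at h2
      simp only [hx, hy, false_or, le_refl, true_iff] at h1 h2
      exact le_antisymm h2 h1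
  -- If `E` were some `G x`, the part removed would have a least element, making `a` and `b`
  -- comparable, or the part added a greatest one, making `g` and `h` comparable.
  have hE : ∀ x, G x ≠ E := by
    intro x hxE
    by_cases hc : c ∈ I
    · have ha : a ∈ I := I.lower hac.le hc
      have hb : b ∈ I := I.lower hbc.le hc
      simp only [E, hc, if_true] at hxE
      have hEI : E < I := by
        simp only [E, hc, if_true]; exact inf_le_left.trans_lt (dn_lt ha)
      by_cases hx : x ∈ I <;> simp only [G, hx, if_true, if_false] at hxE
      · have key : ∀ i, i ∈ dn x ↔ i ∈ dn a ∧ i ∈ dn b := fun i => by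
          rw [hxE, LowerSet.mem_inf_iff]
        have k1 := key a
        have k2 := key b
        have k3 := key x
        simp only [mem_dn, ha, hb, hx, le_refl, true_and, not_true, false_and, and_false,
          iff_false, not_not, false_iff, not_and] at k1 k2 k3
        by_cases hax : a ≤ x
        · exact hab (hax.trans k2)
        · exact hba ((k3 hax).trans k1)
      · have := lt_up hx
        rw [hxE] at this
        exact absurd (this.trans_le (inf_le_left.trans (dn_lt ha).le)) (lt_irrefl _)
    · have hg : g ∉ I := fun h => hc (I.lower hcg.le h)
      have hh : h ∉ I := fun h => hc (I.lower hch.le h)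
      simp only [E, hc, if_false] at hxE
      by_cases hx : x ∈ I <;> simp only [G, hx, if_true, if_false] at hxE
      · have := dn_lt hx
        rw [hxE] at this
        exact absurd ((lt_up hg).le.trans_lt (le_sup_left.trans_lt this)) (lt_irrefl _)
      · have key : ∀ i, i ∈ up x ↔ i ∈ up g ∨ i ∈ up h := fun i => by
          rw [hxE, LowerSet.mem_sup_iff]
        have k1 := key g
        have k2 := key h
        have k3 := key x
        simp only [mem_up, hg, hh, hx, le_refl, false_or, true_or, or_true, iff_true,
          true_iff] at k1 k2 k3
        rcases k3 with k3 | k3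
        · exact hhg (k2.trans k3)
        · exact hgh (k1.trans k3)
  refine ⟨fun o => o.elim E G, ?_, ?_⟩
  · rintro (_ | x) (_ | y) hxy
    · rfl
    · exact absurd hxy.symm (hE y)
    · exact absurd hxy (hE x)
    · exact congrArg some (hG hxy)
  rintro (_ | x)
  · simp only [Option.elim, E]
    split_ifs with hc
    · have ha : a ∈ I := I.lower hac.le hc
      have hb : b ∈ I := I.lower hbc.le hc
      refine (oneSkeleton_adj_of_connected (inf_le_left.trans_lt (dn_lt ha)) ?_).symm
      intro f hf
      -- The removed part is connected: each of its elements lies above `a` or `b`, and `c` links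
      -- these two.
      have hcE : ∀ {z}, a ≤ z ∨ b ≤ z → z ∉ dn a ⊓ dn b := by
        intro z hz hz'
        rw [LowerSet.mem_inf_iff, mem_dn, mem_dn] at hz'
        tauto
      have h1 := hf a c hac.le hc (hcE (.inl le_rfl))
      have h2 := hf b c hbc.le hc (hcE (.inr le_rfl))
      refine ⟨f c, fun u hu hu' => ?_⟩
      rw [LowerSet.mem_inf_iff, mem_dn, mem_dn] at hu'
      by_cases hau : a ≤ u
      · rw [← hf a u hau hu (hcE (.inl le_rfl)), h1]
      · have hbu : b ≤ u := by tauto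
        rw [← hf b u hbu hu (hcE (.inr le_rfl)), h2]
    · have hg : g ∉ I := fun h => hc (I.lower hcg.le h)
      refine oneSkeleton_adj_of_connected ((lt_up hg).trans_le le_sup_left) ?_
      intro f hf
      have hgE : g ∈ up g ⊔ up h := LowerSet.mem_sup_iff.2 (.inl (.inr le_rfl))
      have hhE : h ∈ up g ⊔ up h := LowerSet.mem_sup_iff.2 (.inr (.inr le_rfl))
      have h1 := hf c g hcg.le hgE hc
      have h2 := hf c h hch.le hhE hc
      refine ⟨f c, fun u hu hu' => ?_⟩
      rw [LowerSet.mem_sup_iff, mem_up, mem_up] at hu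
      by_cases hug : u ≤ g
      · rw [hf u g hug hgE hu', h1]
      · rw [hf u h (by tauto) hhE hu', h2]
  · simp only [Option.elim, G]
    split_ifs with hx
    · refine (oneSkeleton_adj_of_connected (dn_lt hx) fun f hf => ⟨f x, fun u hu hu' => ?_⟩).symm
      rw [mem_dn] at hu'
      exact (hf x u (by tauto) hu fun h => ((mem_dn x x).1 h).2 le_rfl).symm
    · refine oneSkeleton_adj_of_connected (lt_up hx) fun f hf => ⟨f x, fun u hu hu' => ?_⟩
      rw [mem_up] at hu
      exact hf u x (by tauto) (.inr le_rfl) hu'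

theorem card_lt_vertexDegree_orderPolytope (hX : HasSubposetX P)
    (v : polytopeVertices (orderPolytope P)) :
    Nat.card P + 1 ≤ vertexDegree (oneSkeleton (orderPolytope P)) v := by
  obtain ⟨I, hI, hv⟩ := exists_eq_indicator_of_mem_polytopeVertices v.2
  obtain rfl : v = lowerSetVertex ⟨I, hI⟩ := Subtype.ext hv
  obtain ⟨F, hF, hadj⟩ := exists_injective_neighbors hX ⟨I, hI⟩
  rw [← Finite.card_option, ← Set.ncard_univ,
    ← Set.ncard_image_of_injective _ (lowerSetVertex_injective.comp hF)]
  refine Set.ncard_le_ncard ?_ (Set.toFinite _)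
  rintro _ ⟨o, -, rfl⟩
  exact hadj o

end OrderPolytope

/-! ### Chain polytope: the neighbours of the origin -/

section ChainPolytope
variable {P : Type*} [PartialOrder P]

/-- Extending to a maximal chain only adds nonnegative terms. -/
theorem sum_le_one_of_isChain [Finite P] {b : P → ℝ} (hb : b ∈ chainPolytope P) {s : Finset P}
    (hs : IsChain (· ≤ ·) (s : Set P)) : ∑ i ∈ s, b i ≤ 1 := by
  obtain ⟨t, ht, hst⟩ := hs.exists_maxChain
  have hfin : t.Finite := Set.toFinite t
  refine le_trans (Finset.sum_le_sum_of_subset_of_nonneg (t := hfin.toFinset) ?_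
    fun i _ _ => hb.1 i) (hb.2 _ (by simpa using ht))
  intro i hi
  exact hfin.mem_toFinset.2 (hst hi)

theorem zero_mem_chainPolytope : (0 : P → ℝ) ∈ chainPolytope P :=
  ⟨fun _ => le_rfl, fun s _ => by simp⟩

theorem mem_chainPolytope_of_le {a b : P → ℝ} (hb : b ∈ chainPolytope P) (h0 : 0 ≤ a)
    (hab : a ≤ b) : a ∈ chainPolytope P :=
  ⟨h0, fun s hs => (Finset.sum_le_sum fun i _ => hab i).trans (hb.2 s hs)⟩

theorem single_mem_chainPolytope [DecidableEq P] {t : ℝ} (h0 : 0 ≤ t) (h1 : t ≤ 1) (x : P) :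
    Pi.single x t ∈ chainPolytope P := by
  refine ⟨fun i => ?_, fun s _ => ?_⟩
  · by_cases h : i = x
    · subst h; simpa
    · simp [h]
  · rw [Finset.sum_pi_single']
    split_ifs <;> simp [h1]

theorem zero_mem_polytopeVertices_chainPolytope [Finite P] :
    (0 : P → ℝ) ∈ polytopeVertices (chainPolytope P) := by
  rw [polytopeVertices, mem_exposedPoints_iff_exposed_singleton]
  refine isExposed_of_tight (K := P) (fun i => -LinearMap.proj i) (fun _ => 0) ?_ fun x => ?_
  · intro x hx k
    simpa using hx.1 k
  · constructor
    · rintro rfl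
      exact ⟨zero_mem_chainPolytope, by simp⟩
    · rintro ⟨-, h⟩
      exact funext fun i => by simpa using h i

variable [Fintype P] [DecidableEq P]

theorem single_mem_polytopeVertices_chainPolytope (x : P) :
    Pi.single x (1 : ℝ) ∈ polytopeVertices (chainPolytope P) := by
  have hle : ∀ a ∈ chainPolytope P, a x ≤ 1 := fun a ha => by
    simpa using sum_le_one_of_isChain ha (s := {x}) (by simp)
  rw [polytopeVertices, mem_exposedPoints_iff_exposed_singleton]
  refine isExposed_of_tight (K := Unit ⊕ {i // i ≠ x})
    (Sum.elim (fun _ => LinearMap.proj x) (fun i => -LinearMap.proj i.1))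
    (Sum.elim (fun _ => 1) (fun _ => 0)) ?_ fun a => ?_
  · rintro a ha (k | k)
    · exact hle a ha
    · simpa using ha.1 k
  · constructor
    · rintro rfl
      refine ⟨single_mem_chainPolytope zero_le_one le_rfl x, ?_⟩
      rintro (k | ⟨k, hk⟩) <;> simp [*]
    · rintro ⟨-, h⟩
      ext i
      by_cases hi : i = x
      · subst hi
        simpa using h (.inl ())
      · simpa [hi] using h (.inr ⟨i, hi⟩)

theorem isExposed_segment_zero_single (x : P) :
    IsExposed ℝ (chainPolytope P) (segment ℝ (0 : P → ℝ) (Pi.single x 1)) := by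
  refine isExposed_of_tight (K := {i // i ≠ x}) (fun i => -LinearMap.proj i.1) (fun _ => 0) ?_
    fun a => ?_
  · intro a ha k
    simpa using ha.1 k
  · constructor
    · rintro ⟨s, t, hs, ht, hst, rfl⟩
      have : s • (0 : P → ℝ) + t • Pi.single x 1 = Pi.single x t := by
        rw [← Pi.single_smul]; simp
      rw [this]
      exact ⟨single_mem_chainPolytope ht (by linarith) x, fun k => by simp [k.2]⟩
    · rintro ⟨ha, h⟩
      have hx : a x ≤ 1 := by simpa using sum_le_one_of_isChain ha (s := {x}) (by simp)
      refine ⟨1 - a x, a x, by linarith, ha.1 x, by ring, ?_⟩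
      ext i
      by_cases hi : i = x
      · subst hi; simp
      · simpa [hi, eq_comm] using h ⟨i, hi⟩

/-- The chain polytope is closed under decreasing coordinates within the nonnegative orthant, so `w`
splits into its `x`-part and the rest, both in the polytope. Their midpoint `w / 2` lies on the face
`[0, w]`, so the `x`-part does too, and `w` is supported at `x`. -/
theorem eq_single_of_isExposed_segment {w : P → ℝ} (hw : w ∈ polytopeVertices (chainPolytope P))
    (hw0 : w ≠ 0) (h : IsExposed ℝ (chainPolytope P) (segment ℝ (0 : P → ℝ) w)) :
    ∃ x, w = Pi.single x 1 := by
  have hext := exposedPoints_subset_extremePoints hw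
  have hwC := hext.1
  obtain ⟨x, hx⟩ := Function.ne_iff.1 hw0
  have hxpos : 0 < w x := lt_of_le_of_ne (hwC.1 x) (Ne.symm hx)
  have hu0 : (0 : P → ℝ) ≤ Pi.single x (w x) := Pi.single_nonneg.2 hxpos.le
  have hule : Pi.single x (w x) ≤ w := fun i => by
    by_cases hi : i = x
    · subst hi; simp
    · simpa [hi] using hwC.1 i
  have hu : Pi.single x (w x) ∈ chainPolytope P := mem_chainPolytope_of_le hwC hu0 hule
  have hv : w - Pi.single x (w x) ∈ chainPolytope P :=
    mem_chainPolytope_of_le hwC (sub_nonneg.2 hule) (sub_le_self _ hu0)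
  have hmid : (1 / 2 : ℝ) • w ∈ segment ℝ (0 : P → ℝ) w :=
    ⟨1 / 2, 1 / 2, by norm_num, by norm_num, by norm_num, by simp⟩
  have hmem := h.isExtreme.2 hu hv hmid
    ⟨1 / 2, 1 / 2, by norm_num, by norm_num, by norm_num, by rw [← smul_add]; simp⟩
  obtain ⟨s, t, hs, ht, hst, he⟩ := hmem
  rw [smul_zero, zero_add] at he
  have hsupp : ∀ i, i ≠ x → w i = 0 := by
    have hex := congrFun he x
    simp only [Pi.smul_apply, smul_eq_mul, Pi.single_eq_same] at hex
    have ht1 : t = 1 := mul_right_cancel₀ hx (by rw [hex, one_mul])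
    intro i hi
    have := congrFun he i
    simpa [ht1, hi] using this
  have hwx : w = Pi.single x (w x) := by
    ext i
    by_cases hi : i = x
    · subst hi; simp
    · simp [hi, hsupp i hi]
  have hx1 : w x ≤ 1 := by simpa using sum_le_one_of_isChain hwC (s := {x}) (by simp)
  refine ⟨x, ?_⟩
  by_contra hne
  have hlt : w x < 1 := lt_of_le_of_ne hx1 fun h => hne (by rw [hwx, h])
  -- With `0 < w x < 1`, `w` would be interior to the segment from 0 to the unit vector at `x`.
  have := hext.2 zero_mem_chainPolytope (single_mem_chainPolytope zero_le_one le_rfl x)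
    ⟨1 - w x, w x, by linarith, hxpos, by ring, by
      rw [smul_zero, zero_add, ← Pi.single_smul, smul_eq_mul, mul_one]; exact hwx.symm⟩
  exact hw0 this.symm

theorem vertexDegree_zero_chainPolytope :
    vertexDegree (oneSkeleton (chainPolytope P))
      ⟨0, zero_mem_polytopeVertices_chainPolytope⟩ = Fintype.card P := by
  let F : P → polytopeVertices (chainPolytope P) := fun x =>
    ⟨Pi.single x 1, single_mem_polytopeVertices_chainPolytope x⟩
  have hF : Function.Injective F := fun x y h => by
    have := congrFun (congrArg Subtype.val h) x
    by_contra hne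
    simp [F, hne] at this
  have : (oneSkeleton (chainPolytope P)).neighborSet
      ⟨0, zero_mem_polytopeVertices_chainPolytope⟩ = F '' Set.univ := by
    ext w
    simp only [SimpleGraph.mem_neighborSet, Set.image_univ, Set.mem_range]
    constructor
    · rintro ⟨hne, hexp⟩
      obtain ⟨x, hx⟩ := eq_single_of_isExposed_segment w.2
        (fun h => hne (Subtype.ext h.symm)) hexp
      exact ⟨x, Subtype.ext hx.symm⟩
    · rintro ⟨x, rfl⟩
      refine ⟨fun h => ?_, isExposed_segment_zero_single x⟩
      have := congrFun (congrArg Subtype.val h) x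
      simp [F] at this
  rw [vertexDegree, this, Set.ncard_image_of_injective _ hF, Set.ncard_univ,
    Nat.card_eq_fintype_card]

end ChainPolytope

/-! ### The unimodular map in the absence of the five-element poset -/

section Transfer
-- Recovers `b x` from sums over filters: with `y` the next element of the chain above `x`, `Ici x`
-- is `Ici y` with `x` added. The first case is `x` maximal.
open Classical in
theorem eq_sum_Ici_or_eq_sub {P : Type*} [PartialOrder P] [Fintype P] (b : P → ℝ) {x : P}
    (hx : IsChain (· ≤ ·) (Set.Ici x)) :
    b x = ∑ i with x ≤ i, b i ∨
      ∃ y, x < y ∧ b x = ∑ i with x ≤ i, b i - ∑ i with y ≤ i, b i := by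
  by_cases hne : (Set.Ioi x).Nonempty
  · obtain ⟨y, hy⟩ := (Set.toFinite (Set.Ioi x)).exists_minimal hne
    have hxy : x < y := hy.prop
    refine .inr ⟨y, hxy, ?_⟩
    have : (Finset.univ.filter (x ≤ ·)) = insert x (Finset.univ.filter (y ≤ ·)) := by
      ext i
      simp only [Finset.mem_filter, Finset.mem_univ, true_and, Finset.mem_insert]
      constructor
      · intro hi
        rcases hi.eq_or_lt with h | h
        · exact .inl h.symm
        · rcases hx.total hi hxy.le with h' | h'
          · exact .inr (hy.le_of_le h h')
          · exact .inr h'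
      · rintro (rfl | h)
        · exact le_rfl
        · exact hxy.le.trans h
    rw [this, Finset.sum_insert (by simpa using hxy.not_ge)]
    ring
  · left
    have : (Finset.univ.filter (x ≤ ·)) = {x} := by
      ext i
      simp only [Finset.mem_filter, Finset.mem_univ, true_and, Finset.mem_singleton]
      refine ⟨fun h => ?_, fun h => h.ge⟩
      by_contra hi
      exact hne ⟨i, lt_of_le_of_ne h (Ne.symm hi)⟩
    rw [this, Finset.sum_singleton]

open Classical in
theorem eq_sum_Iic_or_eq_sub {P : Type*} [PartialOrder P] [Fintype P] (b : P → ℝ) {x : P}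
    (hx : IsChain (· ≤ ·) (Set.Iic x)) :
    b x = ∑ i with i ≤ x, b i ∨
      ∃ y, y < x ∧ b x = ∑ i with i ≤ x, b i - ∑ i with i ≤ y, b i :=
  eq_sum_Ici_or_eq_sub (P := Pᵒᵈ) b (x := x) hx.symm

variable {P : Type*} [PartialOrder P]

/-- An incomparable pair above `c` and one below form the five-element poset; neither pair can
contain `c`, which is comparable to all members. -/
theorem isChain_Ici_or_isChain_Iic (hX : ¬ HasSubposetX P) (c : P) :
    IsChain (· ≤ ·) (Set.Ici c) ∨ IsChain (· ≤ ·) (Set.Iic c) := by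
  by_contra! h
  obtain ⟨h1, h2⟩ := h
  simp only [IsChain, Set.Pairwise, not_forall, not_or] at h1 h2
  obtain ⟨g, hg, h, hh, -, hgh, hhg⟩ := h1
  obtain ⟨a, ha, b, hb, -, hab, hba⟩ := h2
  exact hX ⟨a, b, c, g, h,
    lt_of_le_of_ne ha fun h => hba (h ▸ hb), lt_of_le_of_ne hb fun h => hab (h ▸ ha),
    lt_of_le_of_ne hg fun h => hgh (h ▸ hh), lt_of_le_of_ne hh fun h => hhg (h ▸ hg),
    hab, hba, hgh, hhg⟩

theorem IsChain.union_Iic_Ici {x y : P} (hx : IsChain (· ≤ ·) (Set.Iic x))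
    (hy : IsChain (· ≤ ·) (Set.Ici y)) (hxy : x ≤ y) :
    IsChain (· ≤ ·) (Set.Iic x ∪ Set.Ici y) := by
  rintro i (hi | hi) j (hj | hj) hij
  · exact hx hi hj hij
  · exact .inl (hi.trans (hxy.trans hj))
  · exact .inr (hj.trans (hxy.trans hi))
  · exact hy hi hj hij

variable [Fintype P]

open Classical in
/-- The affine map from the chain polytope to the order polytope of a poset without the five-element
subposet: sum over `Ici x` where this is a chain, and one minus the sum over `Iic x` elsewhere. -/
noncomputable def chainToOrder (b : P → ℝ) (x : P) : ℝ :=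
  if IsChain (· ≤ ·) (Set.Ici x) then ∑ i with x ≤ i, b i else 1 - ∑ i with i ≤ x, b i

-- Monotonicity for `x ≤ y` is inclusion of filters or of ideals when both are of the same type. If
-- only `Ici y` is a chain, it is the chain inequality for `Iic x ∪ Ici y`; the reverse mix cannot
-- occur, since `Ici y ⊆ Ici x`.
open Classical in
theorem chainToOrder_mem {b : P → ℝ} (hX : ¬ HasSubposetX P) (hb : b ∈ chainPolytope P) :
    chainToOrder b ∈ orderPolytope P := by
  have hsum : ∀ s : Finset P, 0 ≤ ∑ i ∈ s, b i := fun s => Finset.sum_nonneg fun i _ => hb.1 i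
  have hup : ∀ {x : P}, IsChain (· ≤ ·) (Set.Ici x) → ∑ i with x ≤ i, b i ≤ 1 := fun h =>
    sum_le_one_of_isChain hb (h.mono fun i hi => by simpa using hi)
  have hdn : ∀ {x : P}, IsChain (· ≤ ·) (Set.Iic x) → ∑ i with i ≤ x, b i ≤ 1 := fun h =>
    sum_le_one_of_isChain hb (h.mono fun i hi => by simpa using hi)
  refine ⟨fun x => ?_, fun x y hxy => ?_⟩
  · unfold chainToOrder
    split_ifs with h
    · exact ⟨hsum _, hup h⟩
    · have h' := hdn ((isChain_Ici_or_isChain_Iic hX x).resolve_left h)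
      exact ⟨sub_nonneg.2 h', sub_le_self _ (hsum _)⟩
  · unfold chainToOrder
    split_ifs with hy hx hx
    · refine Finset.sum_le_sum_of_subset_of_nonneg (fun i => ?_) fun i _ _ => hb.1 i
      simpa using hxy.trans
    · have hx' := (isChain_Ici_or_isChain_Iic hX x).resolve_left hx
      have hlt : ¬ y ≤ x := fun h => hx (le_antisymm hxy h ▸ hy)
      have hdisj : Disjoint (Finset.univ.filter (· ≤ x)) (Finset.univ.filter (y ≤ ·)) := by
        rw [Finset.disjoint_left]
        intro i hi hi'
        exact hlt ((Finset.mem_filter.1 hi').2.trans (Finset.mem_filter.1 hi).2)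
      have := sum_le_one_of_isChain hb
        (s := Finset.univ.filter (· ≤ x) ∪ Finset.univ.filter (y ≤ ·))
        ((hx'.union_Iic_Ici hy hxy).mono fun i hi => by simpa using hi)
      rw [Finset.sum_union hdisj] at this
      linarith
    · exact absurd (hx.mono (Set.Ici_subset_Ici.2 hxy)) hy
    · refine sub_le_sub_left (Finset.sum_le_sum_of_subset_of_nonneg (fun i => ?_)
        fun i _ _ => hb.1 i) _
      simpa using fun h : i ≤ x => h.trans hxy

open Classical in
theorem mem_chainPolytope_of_chainToOrder_mem {b : P → ℝ} (hX : ¬ HasSubposetX P)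
    (hb : chainToOrder b ∈ orderPolytope P) : b ∈ chainPolytope P := by
  obtain ⟨h01, hmono⟩ := hb
  have hD : ∀ {x : P}, IsChain (· ≤ ·) (Set.Ici x) → chainToOrder b x = ∑ i with x ≤ i, b i :=
    fun h => if_pos h
  have hR : ∀ {x : P}, ¬ IsChain (· ≤ ·) (Set.Ici x) →
      chainToOrder b x = 1 - ∑ i with i ≤ x, b i := fun h => if_neg h
  refine ⟨fun x => ?_, fun s hs => ?_⟩
  · by_cases hx : IsChain (· ≤ ·) (Set.Ici x)
    · rcases eq_sum_Ici_or_eq_sub b hx with h | ⟨y, hxy, h⟩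
      · rw [h, ← hD hx]; exact (h01 x).1
      · rw [h, ← hD hx, ← hD (hx.mono (Set.Ici_subset_Ici.2 hxy.le))]
        exact sub_nonneg.2 (hmono x y hxy.le)
    · have hx' := (isChain_Ici_or_isChain_Iic hX x).resolve_left hx
      have h1 := hR hx
      rcases eq_sum_Iic_or_eq_sub b hx' with h | ⟨y, hyx, h⟩
      · linarith [(h01 x).2]
      · have h2 := hR (x := y) fun h => hx (h.mono (Set.Ici_subset_Ici.2 hyx.le))
        linarith [hmono y x hyx.le]
  · let D := s.filter fun x => IsChain (· ≤ ·) (Set.Ici x)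
    let R := s.filter fun x => ¬ IsChain (· ≤ ·) (Set.Ici x)
    have hmin : D.Nonempty → ∃ y ∈ s, IsChain (· ≤ ·) (Set.Ici y) ∧
        ∀ i ∈ s, IsChain (· ≤ ·) (Set.Ici i) → y ≤ i := fun hne => by
      obtain ⟨y, hy⟩ := D.exists_minimal hne
      have hyD := Finset.mem_filter.1 hy.prop
      refine ⟨y, hyD.1, hyD.2, fun i hi hi' => ?_⟩
      rcases hs.isChain.total hi hyD.1 with h | h
      · exact hy.le_of_le (Finset.mem_filter.2 ⟨hi, hi'⟩) h
      · exact h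
    have hmax : R.Nonempty → ∃ x ∈ s, ¬ IsChain (· ≤ ·) (Set.Ici x) ∧
        ∀ i ∈ s, ¬ IsChain (· ≤ ·) (Set.Ici i) → i ≤ x := fun hne => by
      obtain ⟨x, hx⟩ := R.exists_maximal hne
      have hxR := Finset.mem_filter.1 hx.prop
      refine ⟨x, hxR.1, hxR.2, fun i hi hi' => ?_⟩
      rcases hs.isChain.total hi hxR.1 with h | h
      · exact h
      · exact hx.le_of_ge (Finset.mem_filter.2 ⟨hi, hi'⟩) h
    have heq : ∀ t : Finset P, IsChain (· ≤ ·) (t : Set P) → s ⊆ t → s = t := fun t ht hst =>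
      Finset.coe_injective (hs.2 ht (Finset.coe_subset.2 hst))
    rcases D.eq_empty_or_nonempty with hDe | hDne <;> rcases R.eq_empty_or_nonempty with hRe | hRne
    · have : s = ∅ := by
        rw [← Finset.filter_union_filter_not_eq (fun x => IsChain (· ≤ ·) (Set.Ici x)) s]
        exact Finset.union_eq_empty.2 ⟨hDe, hRe⟩
      simp [this]
    · obtain ⟨x, -, hx, hall⟩ := hmax hRne
      have hx' := (isChain_Ici_or_isChain_Iic hX x).resolve_left hx
      rw [heq (Finset.univ.filter (· ≤ x)) (hx'.mono fun i hi => by simpa using hi)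
        fun i hi => by simpa using hall i hi (Finset.filter_eq_empty_iff.1 hDe hi)]
      linarith [hR hx, (h01 x).1]
    · obtain ⟨y, -, hy, hall⟩ := hmin hDne
      rw [heq (Finset.univ.filter (y ≤ ·)) (hy.mono fun i hi => by simpa using hi)
        fun i hi => by simpa using hall i hi (not_not.1 (Finset.filter_eq_empty_iff.1 hRe hi))]
      linarith [hD hy, (h01 y).2]
    · obtain ⟨x, hxs, hx, hallx⟩ := hmax hRne
      obtain ⟨y, hys, hy, hally⟩ := hmin hDne
      have hx' := (isChain_Ici_or_isChain_Iic hX x).resolve_left hx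
      have hyx : ¬ y ≤ x := fun h => hx (hy.mono (Set.Ici_subset_Ici.2 h))
      have hxy : x ≤ y := (hs.isChain.total hxs hys).resolve_right hyx
      have hdisj : Disjoint (Finset.univ.filter (· ≤ x)) (Finset.univ.filter (y ≤ ·)) := by
        rw [Finset.disjoint_left]
        intro i hi hi'
        exact hyx ((Finset.mem_filter.1 hi').2.trans (Finset.mem_filter.1 hi).2)
      rw [heq (Finset.univ.filter (· ≤ x) ∪ Finset.univ.filter (y ≤ ·))
        ((hx'.union_Iic_Ici hy hxy).mono fun i hi => by simpa using hi) fun i hi => ?_,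
        Finset.sum_union hdisj]
      · linarith [hR hx, hD hy, hmono x y hxy]
      · by_cases h : IsChain (· ≤ ·) (Set.Ici i)
        · simpa using Or.inr (hally i hi h)
        · simpa using Or.inl (hallx i hi h)

open Classical in
/-- The matrix of the linear part of `chainToOrder`. -/
noncomputable def chainToOrderMatrix (P : Type*) [PartialOrder P] : Matrix P P ℤ :=
  fun i j => if IsChain (· ≤ ·) (Set.Ici j) then if j ≤ i then 1 else 0
    else if i ≤ j then -1 else 0

open Classical in
theorem unimodularlyEquivalent_of_not_hasSubposetX [DecidableEq P] (hX : ¬ HasSubposetX P) :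
    UnimodularlyEquivalent (orderPolytope P) (chainPolytope P) := by
  refine unimodularlyEquivalent_of_preimage (chainToOrderMatrix P)
    (fun j => if IsChain (· ≤ ·) (Set.Ici j) then 0 else 1) ?_ fun b => ?_
  · let e : P → LinearExtension P ⊕ₗ (LinearExtension P)ᵒᵈ := fun x =>
      if IsChain (· ≤ ·) (Set.Ici x) then Sum.inrₗ (OrderDual.toDual (toLinearExtension x))
      else Sum.inlₗ (toLinearExtension x)
    have hinj : Function.Injective (toLinearExtension : P → LinearExtension P) := fun _ _ h => h
    refine det_eq_one_or_neg_one_of_triangular _ e ?_ ?_ ?_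
    · intro x y hxy
      simp only [e] at hxy
      split_ifs at hxy
      · exact hinj (OrderDual.toDual.injective (Sum.inr_injective (toLex.injective hxy)))
      · exact absurd (toLex.injective hxy) Sum.inr_ne_inl
      · exact absurd (toLex.injective hxy) Sum.inl_ne_inr
      · exact hinj (Sum.inl_injective (toLex.injective hxy))
    · intro i j hij
      simp only [chainToOrderMatrix] at hij
      split_ifs at hij with hj hji hij'
      · have hi : IsChain (· ≤ ·) (Set.Ici i) := hj.mono (Set.Ici_subset_Ici.2 hji)
        simp only [e, hi, hj, if_true]
        exact Sum.Lex.inr_le_inr_iff.2 (OrderDual.toDual_le_toDual.2 (toLinearExtension.monotone hji))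
      · exact absurd rfl hij
      · have hi : ¬ IsChain (· ≤ ·) (Set.Ici i) := fun h =>
          hj (h.mono (Set.Ici_subset_Ici.2 hij'))
        simp only [e, hi, hj, if_false]
        exact Sum.Lex.inl_le_inl_iff.2 (toLinearExtension.monotone hij')
      · exact absurd rfl hij
    · intro i
      simp only [chainToOrderMatrix, le_refl, if_true]
      split_ifs <;> simp
  · have : Matrix.vecMul b ((chainToOrderMatrix P).map (Int.cast : ℤ → ℝ)) +
        (fun j => (((if IsChain (· ≤ ·) (Set.Ici j) then 0 else 1 : ℤ)) : ℝ)) =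
        chainToOrder b := by
      ext j
      simp only [Pi.add_apply, Matrix.vecMul, dotProduct, Matrix.map_apply, chainToOrderMatrix,
        chainToOrder]
      split_ifs with hj
      · simp [Finset.sum_filter]
      · rw [Finset.sum_filter, sub_eq_neg_add, ← Finset.sum_neg_distrib, Int.cast_one]
        congr 1
        exact Finset.sum_congr rfl fun i _ => by split_ifs <;> simp
    rw [this]
    exact ⟨chainToOrder_mem hX, mem_chainPolytope_of_chainToOrder_mem hX⟩

end Transfer

theorem mainTheorem2 (P : Type*) [PartialOrder P] [Fintype P] [DecidableEq P] :
    (degreeSequence (oneSkeleton (orderPolytope P)) =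
        degreeSequence (oneSkeleton (chainPolytope P)) ↔
      UnimodularlyEquivalent (orderPolytope P) (chainPolytope P)) ∧
    (¬ UnimodularlyEquivalent (orderPolytope P) (chainPolytope P) →
      HasSubposetX P ∧
      (∃ h0 : (0 : P → ℝ) ∈ polytopeVertices (chainPolytope P),
        vertexDegree (oneSkeleton (chainPolytope P)) ⟨0, h0⟩ = Fintype.card P) ∧
      ∀ v : polytopeVertices (orderPolytope P),
        Fintype.card P + 1 ≤ vertexDegree (oneSkeleton (orderPolytope P)) v) := by
  have hX : ¬ UnimodularlyEquivalent (orderPolytope P) (chainPolytope P) → HasSubposetX P :=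
    not_imp_comm.1 unimodularlyEquivalent_of_not_hasSubposetX
  have hO : HasSubposetX P → ∀ v : polytopeVertices (orderPolytope P),
      Fintype.card P + 1 ≤ vertexDegree (oneSkeleton (orderPolytope P)) v := fun h v => by
    simpa using card_lt_vertexDegree_orderPolytope h v
  refine ⟨⟨fun h => ?_, fun h => h.degreeSequence_eq⟩, fun h =>
    ⟨hX h, ⟨zero_mem_polytopeVertices_chainPolytope, vertexDegree_zero_chainPolytope⟩, hO (hX h)⟩⟩
  by_contra hne
  -- `|P|` is the degree of the origin, but is below every degree in the order polytope.
  have hmem : Fintype.card P ∈ degreeSequence (oneSkeleton (chainPolytope P)) :=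
    mem_degreeSequence.2 ⟨_, vertexDegree_zero_chainPolytope⟩
  rw [← h] at hmem
  obtain ⟨v, hv⟩ := mem_degreeSequence.1 hmem
  have := hO (hX hne) v
  omega
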